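/- Let $G$ be a finite group and let $V$ be an $n$-dimensional real representation of $G$. For $N\ge 0$ let $EG_N=G*\cdots*G$ be the join of $N+1$ copies of the discrete set $G$: a simplicial complex whose faces are the non-empty sets of vertices with at most one vertex in each copy, with $G$ acting by left multiplication in every copy; let $EG_\infty=\bigcup_N EG_N$. Let $\pm\mathbb Z$ be the $G$-module $\mathbb Z$ on which $g$ acts by the sign of $\det(g|_V)$. The equivariant Euler class $e(V)\in H^n_G(EG_\infty;\pm\mathbb Z)$ (defined up to sign, by the choice of an orientation of $V$) is the class of the cocycle that counts with signs the zeros, on the $n$-faces of $EG_\infty$, of a $G$-equivariant map $F:EG_\infty\to V$ that is affine on every face and generic, i.e. any at most $n$ vertices of a common face have linearly independent images. Let $Z\subseteq EG_N$ be a $G$-invariant subcomplex such that the restriction of $e(V)$ to $H^n_G(Z;\pm\mathbb Z)$ is non-zero. Then $Z$ has at least $2^n$ $G$-orbits of $n$-dimensional faces. -/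

import Mathlib

namespace EulerJoin

/-! ### The joins `G * ⋯ * G` -/

/-- A vertex of a join of copies of `G` indexed by natural numbers: an element `elt` of `G`,
placed in the copy number `index`. -/
@[ext]
structure Vertex (G : Type*) where
  /-- the number of the factor of the join -/
  index : ℕ
  /-- the element of `G` -/
  elt : G

/-- `G` acts on the vertices by left multiplication in every factor. -/
instance {G : Type*} [Group G] : MulAction G (Vertex G) where
  smul g x := ⟨x.index, g * x.elt⟩
  one_smul x := Vertex.ext rfl (one_mul x.elt)
  mul_smul g h x := Vertex.ext rfl (mul_assoc g h x.elt)

/-- The join of the copies of the discrete set `G` with indices in `I`. Its faces are the nonempty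
finite sets of vertices with at most one vertex in every factor. -/
def joinComplex (G : Type*) (I : Set ℕ) : PreAbstractSimplicialComplex (Vertex G) where
  faces := {s | s.Nonempty ∧ (∀ x ∈ s, x.index ∈ I) ∧
    ∀ x ∈ s, ∀ y ∈ s, x.index = y.index → x = y}
  isRelLowerSet_faces := fun _ hs =>
    ⟨hs.1, fun _ hts ht => ⟨ht, fun x hx => hs.2.1 x (hts hx),
      fun x hx y hy => hs.2.2 x (hts hx) y (hts hy)⟩⟩

/-- `EG_N`, the join of `N + 1` copies of `G`. -/
def EG (G : Type*) (N : ℕ) : PreAbstractSimplicialComplex (Vertex G) := joinComplex G {k | k ≤ N}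

/-- `EG_∞`, the join of countably many copies of `G`, the union of all `EG_N`. -/
def EGInf (G : Type*) : PreAbstractSimplicialComplex (Vertex G) := joinComplex G Set.univ

theorem EG_le_EGInf (G : Type*) (N : ℕ) : EG G N ≤ EGInf G :=
  fun _ hs => ⟨hs.1, fun _ _ => Set.mem_univ _, hs.2.2⟩

/-! ### Group actions on simplicial complexes and orbits of faces -/

/-- The translate `g • s` of a finite set of vertices. -/
def translate {G α : Type*} [Group G] [MulAction G α] (g : G) (s : Finset α) : Finset α :=
  s.map (MulAction.toPerm g).toEmbedding

/-- A complex is `G`-invariant if the translates of its faces are faces. -/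
def IsInvariant (G : Type*) {α : Type*} [Group G] [MulAction G α]
    (X : PreAbstractSimplicialComplex α) : Prop :=
  ∀ (g : G), ∀ s ∈ X.faces, translate g s ∈ X.faces

/-- The set of `G`-orbits of `n`-faces (faces with `n + 1` vertices) of `X`. -/
def faceOrbits (G : Type*) {α : Type*} [Group G] [MulAction G α]
    (X : PreAbstractSimplicialComplex α) (n : ℕ) : Set (Set (Finset α)) :=
  {O | ∃ s ∈ X.faces, s.card = n + 1 ∧ O = {t | ∃ g : G, t = translate g s}}

/-! ### Equivariant simplicial cohomology -/

/-- The ordered `n`-simplices of `X`: the `(n + 1)`-tuples of vertices, repetitions allowed, that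
lie in a common face of `X`. They form the basis of the ordered simplicial chain complex. -/
def Simplex {α : Type*} (X : PreAbstractSimplicialComplex α) (n : ℕ) : Type _ :=
  {v : Fin (n + 1) → α // ∃ s ∈ X.faces, ∀ i, v i ∈ s}

/-- The `i`-th facet of an ordered simplex, which omits the `i`-th vertex. -/
def Simplex.facet {α : Type*} {X : PreAbstractSimplicialComplex α} {n : ℕ}
    (v : Simplex X (n + 1)) (i : Fin (n + 2)) : Simplex X n :=
  ⟨fun k => v.1 (i.succAbove k), v.2.imp fun _ hs => ⟨hs.1, fun k => hs.2 (i.succAbove k)⟩⟩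

/-- An ordered simplex of a subcomplex, as an ordered simplex of the complex. -/
def Simplex.incl {α : Type*} {X Y : PreAbstractSimplicialComplex α} (h : Y ≤ X) {n : ℕ}
    (v : Simplex Y n) : Simplex X n :=
  ⟨v.1, v.2.imp fun _ hs => ⟨h hs.1, hs.2⟩⟩

section Cohomology

variable {G α A : Type*} [Group G] [MulAction G α] [AddCommGroup A]

/-- The group of `G`-equivariant `n`-cochains of `X` with coefficients in the `G`-module `A`:
the functions `c` on ordered `n`-simplices with `c (g • v) = g • c v`. -/
def cochains (τ : Representation ℤ G A) (X : PreAbstractSimplicialComplex α) (n : ℕ) :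
    AddSubgroup (Simplex X n → A) where
  carrier := {c | ∀ (g : G) (v w : Simplex X n), (∀ i, w.1 i = g • v.1 i) → c w = τ g (c v)}
  zero_mem' := fun g _ _ _ => by simp
  add_mem' := fun {a b} ha hb g v w h => by simp [ha g v w h, hb g v w h]
  neg_mem' := fun {a} ha g v w h => by simp [ha g v w h]

/-- The simplicial coboundary `(d c)(v) = ∑ i, (-1) ^ i c(v without its i-th vertex)`. -/
def coboundary (τ : Representation ℤ G A) (X : PreAbstractSimplicialComplex α) (n : ℕ) :
    cochains τ X n →+ cochains τ X (n + 1) where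
  toFun c := ⟨fun v => ∑ i : Fin (n + 2), (-1 : ℤ) ^ (i : ℕ) • c.1 (v.facet i), by
    intro g v w h
    simp only [map_sum, map_zsmul]
    refine Finset.sum_congr rfl fun i _ => ?_
    rw [c.2 g (v.facet i) (w.facet i) fun k => h _]⟩
  map_zero' := by ext v; simp
  map_add' a b := by ext v; simp [Finset.sum_add_distrib]

/-- The subgroup of `n`-cocycles. -/
def cocycles (τ : Representation ℤ G A) (X : PreAbstractSimplicialComplex α) (n : ℕ) :
    AddSubgroup (cochains τ X n) :=
  (coboundary τ X n).ker

/-- The subgroup of `n`-coboundaries; it is trivial for `n = 0`. -/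
def coboundaries (τ : Representation ℤ G A) (X : PreAbstractSimplicialComplex α) :
    (n : ℕ) → AddSubgroup (cochains τ X n)
  | 0 => ⊥
  | n + 1 => (coboundary τ X n).range

/-- The equivariant cohomology group `H^n_G(X; A)`: `n`-cocycles modulo `n`-coboundaries of the
complex of equivariant cochains. (For a free action, as on the joins of `G`, this is the cohomology
of `X / G` with local coefficients `A`.) -/
abbrev Cohomology (τ : Representation ℤ G A) (X : PreAbstractSimplicialComplex α) (n : ℕ) :
    Type _ :=
  cocycles τ X n ⧸ (coboundaries τ X n).addSubgroupOf (cocycles τ X n)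

/-- The cohomology class of a cocycle. -/
def cohomologyClass (τ : Representation ℤ G A) (X : PreAbstractSimplicialComplex α) (n : ℕ)
    (c : cocycles τ X n) : Cohomology τ X n :=
  QuotientAddGroup.mk c

/-- Restriction of cochains to a subcomplex. -/
def restrictCochain (τ : Representation ℤ G A) {X Y : PreAbstractSimplicialComplex α} (h : Y ≤ X)
    (n : ℕ) : cochains τ X n →+ cochains τ Y n where
  toFun c := ⟨fun v => c.1 (v.incl h), fun g v w hvw => c.2 g (v.incl h) (w.incl h) hvw⟩
  map_zero' := rfl
  map_add' _ _ := rfl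

theorem coboundary_restrictCochain (τ : Representation ℤ G A)
    {X Y : PreAbstractSimplicialComplex α} (h : Y ≤ X) (n : ℕ) (c : cochains τ X n) :
    coboundary τ Y n (restrictCochain τ h n c) =
      restrictCochain τ h (n + 1) (coboundary τ X n c) :=
  rfl

/-- Restriction of cocycles to a subcomplex. -/
def restrictCocycle (τ : Representation ℤ G A) {X Y : PreAbstractSimplicialComplex α} (h : Y ≤ X)
    (n : ℕ) : cocycles τ X n →+ cocycles τ Y n :=
  ((restrictCochain τ h n).comp (cocycles τ X n).subtype).codRestrict (cocycles τ Y n) fun c => by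
    have hc : coboundary τ X n c.1 = 0 := c.2
    change coboundary τ Y n (restrictCochain τ h n c.1) = 0
    rw [coboundary_restrictCochain, hc, map_zero]

/-- The restriction homomorphism `H^n_G(X; A) → H^n_G(Y; A)` to a subcomplex `Y` of `X`. -/
def restrict (τ : Representation ℤ G A) {X Y : PreAbstractSimplicialComplex α} (h : Y ≤ X)
    (n : ℕ) : Cohomology τ X n →+ Cohomology τ Y n :=
  QuotientAddGroup.map _ _ (restrictCocycle τ h n) (by
    intro c hc
    rw [AddSubgroup.mem_addSubgroupOf] at hc
    rw [AddSubgroup.mem_comap, AddSubgroup.mem_addSubgroupOf]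
    change restrictCochain τ h n c.1 ∈ coboundaries τ Y n
    cases n with
    | zero =>
      have hc' : c.1 = 0 := hc
      rw [hc', map_zero]
      exact zero_mem _
    | succ n =>
      obtain ⟨a, ha⟩ := hc
      exact ⟨restrictCochain τ h n a, by rw [coboundary_restrictCochain, ha]⟩)

end Cohomology

/-! ### The equivariant Euler class -/

section Euler

variable {G V : Type*} [Group G] [AddCommGroup V] [Module ℝ V]

/-- The coefficient module `±ℤ` of a real representation `ρ`: the integers, on which `g` acts by the
sign of the determinant of `ρ g`. -/
noncomputable def signModule (ρ : Representation ℝ G V) : Representation ℤ G ℤ where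
  toFun g := (SignType.sign (LinearMap.det (ρ g)) : ℤ) • LinearMap.id
  map_one' := by ext; simp
  map_mul' g h := by ext; simp [sign_mul]

/-- A `G`-equivariant map `EG_∞ → V` that is affine on every face, given by its values on the
vertices, and in general position: at most `n` vertices of a face have linearly independent
images. For `n = dim V` the image of a face of dimension less than `n` thus misses the origin, and
an `n`-face whose image contains the origin is mapped injectively, with the origin
in the interior of the image. -/
structure GenericMap (ρ : Representation ℝ G V) (n : ℕ) where
  /-- the values on the vertices -/
  toFun : Vertex G → V
  equivariant : ∀ (g : G) (x : Vertex G), toFun (g • x) = ρ g (toFun x)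
  generic : ∀ s ∈ (EGInf G).faces, s.card ≤ n → LinearIndepOn ℝ toFun (s : Set (Vertex G))

open Classical in
/-- The signed number (`0`, `1` or `-1`) of zeros in a simplex of the affine map to `V` with
values `p 0, …, p n` at the vertices, with respect to the orientation of `V` given by
the basis `b`. -/
noncomputable def zeroCount {n : ℕ} (b : Module.Basis (Fin n) ℝ V) (p : Fin (n + 1) → V) : ℤ :=
  if (0 : V) ∈ convexHull ℝ (Set.range p) then
    (SignType.sign (b.det fun i : Fin n => p i.succ - p 0) : ℤ)
  else 0

theorem zeroCount_map {n : ℕ} (b : Module.Basis (Fin n) ℝ V) (f : V ≃ₗ[ℝ] V)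
    (p : Fin (n + 1) → V) :
    zeroCount b (fun i => f (p i)) =
      (SignType.sign (LinearMap.det (f : V →ₗ[ℝ] V)) : ℤ) * zeroCount b p := by
  have h1 : (0 : V) ∈ convexHull ℝ (Set.range fun i => f (p i)) ↔
      (0 : V) ∈ convexHull ℝ (Set.range p) := by
    have h2 : (Set.range fun i => f (p i)) = (f : V →ₗ[ℝ] V) '' Set.range p := by
      rw [← Set.range_comp]; rfl
    rw [h2, ← LinearMap.image_convexHull]
    constructor
    · rintro ⟨x, hx, h⟩
      have : x = 0 := by simpa using h
      rwa [this] at hx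
    · exact fun h => ⟨0, h, map_zero _⟩
  have h3 := b.det_comp (f : V →ₗ[ℝ] V) (fun i : Fin n => p i.succ - p 0)
  have h4 : ((f : V →ₗ[ℝ] V) ∘ fun i : Fin n => p i.succ - p 0) =
      fun i : Fin n => f (p i.succ) - f (p 0) := by
    ext i; simp
  rw [h4] at h3
  unfold zeroCount
  rw [h3, sign_mul]
  by_cases h : (0 : V) ∈ convexHull ℝ (Set.range p)
  · rw [if_pos h, if_pos (h1.2 h)]
    simp
  · rw [if_neg h, if_neg (h1.not.2 h), mul_zero]

/-- The equivariant cochain that counts the zeros of a map to `V` with signs. -/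
noncomputable def eulerCochain (ρ : Representation ℝ G V) {n : ℕ} (b : Module.Basis (Fin n) ℝ V)
    (F : GenericMap ρ n) : cochains (signModule ρ) (EGInf G) n :=
  ⟨fun v => zeroCount b fun i => F.toFun (v.1 i), by
    intro g v w h
    let f : V ≃ₗ[ℝ] V := LinearEquiv.ofLinearMap (ρ g) (ρ g⁻¹)
      (by rw [← Module.End.mul_eq_comp, ← map_mul, mul_inv_cancel, map_one]; rfl)
      (by rw [← Module.End.mul_eq_comp, ← map_mul, inv_mul_cancel, map_one]; rfl)
    have h1 : (fun i => F.toFun (w.1 i)) = fun i => f (F.toFun (v.1 i)) := by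
      ext i
      rw [h i, F.equivariant]
      rfl
    exact (congrArg (zeroCount b) h1).trans (zeroCount_map b f fun i => F.toFun (v.1 i))⟩

/-- Zero is in the hull of a tuple iff it is a convex combination. -/
theorem zero_mem_convexHull_iff {m : ℕ} (p : Fin m → V) :
    (0 : V) ∈ convexHull ℝ (Set.range p) ↔
      ∃ a : Fin m → ℝ, (∀ k, 0 ≤ a k) ∧ ∑ k, a k = 1 ∧ ∑ k, a k • p k = 0 := by
  rw [convexHull_range_eq_exists_affineCombination]
  constructor
  · rintro ⟨s, w, h0, h1, h2⟩
    rw [Finset.affineCombination_eq_linear_combination _ _ _ h1] at h2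
    classical
    refine ⟨fun k => if k ∈ s then w k else 0, fun k => ?_, ?_, ?_⟩
    · dsimp only
      split_ifs with h
      exacts [h0 k h, le_rfl]
    · simpa using h1
    · simpa [ite_smul] using h2
  · rintro ⟨a, h0, h1, h2⟩
    refine ⟨Finset.univ, a, fun k _ => h0 k, h1, ?_⟩
    rw [Finset.affineCombination_eq_linear_combination _ _ _ h1, h2]

/-- An affine dependence of `n + 2` points of an `n`-dimensional space is proportional to the
signed volumes of the facets. -/
theorem volume_relation {n : ℕ} (b : Module.Basis (Fin n) ℝ V) (p : Fin (n + 2) → V)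
    (a : Fin (n + 2) → ℝ) (h0 : ∑ k, a k = 0) (h1 : ∑ k, a k • p k = 0) (i j : Fin (n + 2)) :
    a j * ((-1) ^ (i : ℕ) * b.det fun k : Fin n => p (i.succAbove k.succ) - p (i.succAbove 0)) =
    a i * ((-1) ^ (j : ℕ) *
      b.det fun k : Fin n => p (j.succAbove k.succ) - p (j.succAbove 0)) := by
  classical
  by_cases ha : a = 0
  · simp [ha]
  let x : Fin (n + 2) → ℝ := fun k => (if k = i then a j else 0) - (if k = j then a i else 0)
  let N : Matrix (Fin (n + 2)) (Fin (n + 2)) ℝ := Matrix.of fun k =>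
    Fin.cons (x k) (Fin.cons 1 fun l => b.repr (p k) l)
  have hN : N.det = 0 := by
    rw [← Matrix.exists_vecMul_eq_zero_iff]
    refine ⟨a, ha, ?_⟩
    ext l
    rw [Matrix.vecMul, dotProduct]
    refine Fin.cases ?_ (fun l => Fin.cases ?_ (fun l => ?_) l) l
    · simp [N, x, mul_sub, Finset.sum_sub_distrib]
      ring
    · simpa [N] using h0
    · have := congrArg (fun v => b.repr v l) h1
      simpa [N] using this
  have hdet : ∀ k : Fin (n + 2), (N.submatrix k.succAbove Fin.succ).det =
      b.det fun l : Fin n => p (k.succAbove l.succ) - p (k.succAbove 0) := by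
    intro k
    set q : Fin (n + 1) → V := fun l => p (k.succAbove l) with hq
    let M : Matrix (Fin (n + 1)) (Fin (n + 1)) ℝ :=
      Matrix.of fun l => Fin.cons (if l = 0 then 1 else 0)
        (fun m => b.repr (q l - if l = 0 then 0 else q 0) m)
    have e1 : (N.submatrix k.succAbove Fin.succ).det = M.det := by
      refine Matrix.det_eq_of_forall_row_eq_smul_add_const (fun l => if l = 0 then 0 else 1) 0
        (by simp) fun l m => ?_
      refine Fin.cases ?_ (fun m => ?_) m <;> by_cases hl : l = 0 <;>
        simp [N, M, hl, hq]
    rw [e1, Matrix.det_succ_column_zero, Fin.sum_univ_succ]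
    simp only [M, Matrix.of_apply, Fin.cons_zero, Fin.succ_ne_zero]
    simp
    rw [Module.Basis.det_apply, ← Matrix.det_transpose]
    congr 1
    ext l m
    simp [Module.Basis.toMatrix_apply, hq, Matrix.transpose_apply]
  rw [Matrix.det_succ_column_zero] at hN
  simp only [hdet] at hN
  simp only [N, Fin.cons_zero, x, mul_sub, sub_mul, Matrix.of_apply, Finset.sum_sub_distrib, mul_ite, ite_mul,
    mul_zero, zero_mul, Finset.sum_ite_eq', Finset.mem_univ, if_true] at hN
  linarith

theorem sign_add_sign {n : ℕ} (b : Module.Basis (Fin n) ℝ V) (p : Fin (n + 2) → V)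
    (a : Fin (n + 2) → ℝ) (h0 : ∑ k, a k = 0) (h1 : ∑ k, a k • p k = 0) (i j : Fin (n + 2))
    (hi : 0 < a i) (hj : a j < 0) :
    (-1 : ℤ) ^ (i : ℕ) *
        (SignType.sign (b.det fun k : Fin n => p (i.succAbove k.succ) - p (i.succAbove 0)) : ℤ) +
      (-1 : ℤ) ^ (j : ℕ) *
        (SignType.sign (b.det fun k : Fin n => p (j.succAbove k.succ) - p (j.succAbove 0)) : ℤ)
      = 0 := by
  have key := volume_relation b p a h0 h1 i j
  have hs : ∀ (m : ℕ) (x : ℝ), (-1 : ℤ) ^ m * (SignType.sign x : ℤ) =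
      (SignType.sign ((-1) ^ m * x) : ℤ) := by
    intro m x
    rcases neg_one_pow_eq_or ℤ m with h | h
    · rcases neg_one_pow_eq_or ℝ m with h' | h'
      · simp [h, h']
      · exfalso
        have : ((-1 : ℤ) ^ m : ℝ) = -1 := by exact_mod_cast h'
        rw [← Int.cast_pow, h] at this
        norm_num at this
    · rcases neg_one_pow_eq_or ℝ m with h' | h'
      · exfalso
        have : ((-1 : ℤ) ^ m : ℝ) = 1 := by exact_mod_cast h'
        rw [← Int.cast_pow, h] at this
        norm_num at this
      · simp [h, h', Left.sign_neg]
  rw [hs, hs]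
  set x := (-1 : ℝ) ^ (i : ℕ) *
    b.det fun k : Fin n => p (i.succAbove k.succ) - p (i.succAbove 0)
  set y := (-1 : ℝ) ^ (j : ℕ) *
    b.det fun k : Fin n => p (j.succAbove k.succ) - p (j.succAbove 0)
  rcases lt_trichotomy x 0 with hx | hx | hx
  · have hy : 0 < y := by
      by_contra hy
      nlinarith [mul_pos_of_neg_of_neg hj hx, mul_nonneg hi.le (sub_nonneg.2 (not_lt.1 hy))]
    simp [sign_neg hx, sign_pos hy]
  · have hy : y = 0 := by
      rw [hx, mul_zero] at key
      exact (mul_eq_zero.1 key.symm).resolve_left hi.ne'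
    simp [hx, hy]
  · have hy : y < 0 := by
      by_contra hy
      nlinarith [mul_neg_of_neg_of_pos hj hx, mul_nonneg hi.le (not_lt.1 hy)]
    simp [sign_pos hx, sign_neg hy]

theorem zero_mem_facet_iff {n : ℕ} (p : Fin (n + 2) → V) (i : Fin (n + 2)) :
    (0 : V) ∈ convexHull ℝ (Set.range fun k => p (i.succAbove k)) ↔
      ∃ a : Fin (n + 2) → ℝ, (∀ k, 0 ≤ a k) ∧ a i = 0 ∧ ∑ k, a k = 1 ∧ ∑ k, a k • p k = 0 := by
  rw [zero_mem_convexHull_iff]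
  constructor
  · rintro ⟨a, h0, h1, h2⟩
    refine ⟨i.insertNth 0 a, fun k => ?_, by simp, ?_, ?_⟩
    · rcases Fin.eq_self_or_eq_succAbove i k with rfl | ⟨k, rfl⟩
      · simp
      · simpa using h0 k
    · simpa [Fin.sum_univ_succAbove _ i] using h1
    · simpa [Fin.sum_univ_succAbove _ i] using h2
  · rintro ⟨a, h0, hi, h1, h2⟩
    rw [Fin.sum_univ_succAbove _ i, hi, zero_add] at h1
    rw [Fin.sum_univ_succAbove _ i, hi, zero_smul, zero_add] at h2
    exact ⟨fun k => a (i.succAbove k), fun k => h0 _, h1, h2⟩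

/-- The signed zero counts of the facets of a simplex in general position add up to zero. -/
theorem sum_zeroCount_facet {n : ℕ} (b : Module.Basis (Fin n) ℝ V) (p : Fin (n + 2) → V)
    (hp : ∀ i j, i ≠ j → ∀ a : Fin (n + 2) → ℝ, ∑ k, a k • p k = 0 → a i = 0 → a j = 0 → a = 0) :
    ∑ i : Fin (n + 2), (-1 : ℤ) ^ (i : ℕ) * zeroCount b (fun k => p (i.succAbove k)) = 0 := by
  classical
  by_cases hI : ∃ i : Fin (n + 2), (0 : V) ∈ convexHull ℝ (Set.range fun k => p (i.succAbove k))
  swap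
  · push Not at hI
    exact Finset.sum_eq_zero fun i _ => by simp [zeroCount, hI i]
  obtain ⟨i, hi⟩ := hI
  obtain ⟨l, l0, li, l1, l2⟩ := (zero_mem_facet_iff p i).1 hi
  have lne : l ≠ 0 := by rintro rfl; simp at l1
  have lpos : ∀ k, k ≠ i → 0 < l k := fun k hk =>
    lt_of_le_of_ne (l0 k) fun h => lne (hp k i hk l l2 h.symm li)
  -- a second relation
  obtain ⟨c, c2, ci⟩ : ∃ c : Fin (n + 2) → ℝ, ∑ k, c k • p k = 0 ∧ 0 < c i := by
    obtain ⟨j, hj⟩ := exists_ne i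
    have hdep : ¬ LinearIndependent ℝ fun k => p (j.succAbove k) := by
      intro h
      have := b.finiteDimensional_of_finite
      have := h.fintype_card_le_finrank
      rw [Module.finrank_eq_card_basis b] at this
      simp at this
    rw [Fintype.not_linearIndependent_iff] at hdep
    obtain ⟨g, g2, k, gk⟩ := hdep
    set c : Fin (n + 2) → ℝ := j.insertNth 0 g with hc
    have c2 : ∑ k, c k • p k = 0 := by simpa [hc, Fin.sum_univ_succAbove _ j] using g2
    have ci : c i ≠ 0 := by
      intro h
      have h0 := hp i j hj.symm c c2 h (by simp [hc])
      apply gk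
      have := congrFun h0 (j.succAbove k)
      simpa [hc] using this
    rcases lt_or_gt_of_ne ci with h | h
    · exact ⟨-c, by simpa using c2, by simpa using h⟩
    · exact ⟨c, c2, h⟩
  obtain ⟨j, hj, hmin⟩ : ∃ j, j ≠ i ∧ ∀ k, k ≠ i → c j / l j ≤ c k / l k := by
    obtain ⟨j0, hj0⟩ := exists_ne i
    obtain ⟨j, hj, h⟩ := Finset.exists_min_image (Finset.univ.erase i) (fun k => c k / l k)
      ⟨j0, by simp [hj0]⟩
    exact ⟨j, by simpa using hj, fun k hk => h k (by simp [hk])⟩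
  set m : Fin (n + 2) → ℝ := fun k => c k - c j / l j * l k with hm
  have m2 : ∑ k, m k • p k = 0 := by
    simp only [hm, sub_smul, mul_smul, Finset.sum_sub_distrib, ← Finset.smul_sum, l2, c2]
    simp
  have mi : 0 < m i := by simpa [hm, li] using ci
  have mj : m j = 0 := by
    have := (lpos j hj).ne'
    simp [hm, this]
  have m0 : ∀ k, 0 ≤ m k := by
    intro k
    by_cases hk : k = i
    · rw [hk]; exact mi.le
    · have := (le_div_iff₀ (lpos k hk)).1 (hmin k hk)
      simpa [hm] using this
  have mne : m ≠ 0 := fun h => mi.ne' (congrFun h i)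
  have mpos : ∀ k, k ≠ j → 0 < m k := fun k hk =>
    lt_of_le_of_ne (m0 k) fun h => mne (hp k j hk m m2 h.symm mj)
  have hs : 0 < ∑ k, m k :=
    lt_of_lt_of_le mi (Finset.single_le_sum (fun k _ => m0 k) (Finset.mem_univ i))
  have hj' : (0 : V) ∈ convexHull ℝ (Set.range fun k => p (j.succAbove k)) := by
    refine (zero_mem_facet_iff p j).2 ⟨fun k => m k / ∑ k, m k, fun k => div_nonneg (m0 k) hs.le,
      by simp [mj], ?_, ?_⟩
    · rw [← Finset.sum_div, div_self hs.ne']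
    · simp only [div_eq_inv_mul, mul_smul, ← Finset.smul_sum, m2, smul_zero]
  have huniq : ∀ k, k ≠ i → k ≠ j →
      (0 : V) ∉ convexHull ℝ (Set.range fun t => p (k.succAbove t)) := by
    intro k hki hkj hk
    obtain ⟨e, e0, ek, e1, e2⟩ := (zero_mem_facet_iff p k).1 hk
    have ene : e ≠ 0 := by rintro rfl; simp at e1
    have epos : ∀ t, t ≠ k → 0 < e t := fun t ht =>
      lt_of_le_of_ne (e0 t) fun h => ene (hp t k ht e e2 h.symm ek)
    set r : Fin (n + 2) → ℝ := fun t => e t - e i / m i * m t - e j / l j * l t with hr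
    have r2 : ∑ t, r t • p t = 0 := by
      simp only [hr, sub_smul, mul_smul, Finset.sum_sub_distrib, ← Finset.smul_sum, l2, m2, e2]
      simp
    have hlj := (lpos j hj).ne'
    have hr0 := hp i j hj.symm r r2 (by simp [hr, li, mi.ne']) (by simp [hr, mj, hlj])
    have h3 := congrFun hr0 k
    simp only [hr, ek, Pi.zero_apply] at h3
    have h4 : 0 < e i / m i * m k :=
      mul_pos (div_pos (epos i hki.symm) mi) (mpos k hkj)
    have h5 : 0 < e j / l j * l k :=
      mul_pos (div_pos (epos j hkj.symm) (lpos j hj)) (lpos k hki)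
    linarith
  rw [Finset.sum_eq_add_of_mem i j (Finset.mem_univ i) (Finset.mem_univ j) hj.symm
    fun k _ hk => by simp [zeroCount, huniq k hk.1 hk.2]]
  simp only [zeroCount, hi, hj', if_true]
  refine sign_add_sign b p (fun k => m k / (∑ k, m k) - l k) ?_ ?_ i j ?_ ?_
  · rw [Finset.sum_sub_distrib, ← Finset.sum_div, div_self hs.ne', l1, sub_self]
  · simp only [sub_smul, div_eq_inv_mul, mul_smul, Finset.sum_sub_distrib, ← Finset.smul_sum, m2,
      l2, smul_zero, sub_zero]
  · simpa [li] using div_pos mi hs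
  · simpa [mj] using lpos j hj

theorem eulerCochain_mem_cocycles (ρ : Representation ℝ G V) {n : ℕ}
    (b : Module.Basis (Fin n) ℝ V) (F : GenericMap ρ n) :
    eulerCochain ρ b F ∈ cocycles (signModule ρ) (EGInf G) n := by
  classical
  change coboundary (signModule ρ) (EGInf G) n (eulerCochain ρ b F) = 0
  ext v
  change ∑ i : Fin (n + 2), (-1 : ℤ) ^ (i : ℕ) •
    zeroCount b (fun k => F.toFun (v.1 (i.succAbove k))) = 0
  simp only [smul_eq_mul]
  obtain ⟨s, hs, hv⟩ := v.2
  -- a relation supported on at most `n` vertices of the face is trivial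
  have hgen : ∀ t : Finset (Vertex G), t ⊆ s → t.card ≤ n →
      LinearIndepOn ℝ F.toFun (t : Set (Vertex G)) := by
    intro t ht htn
    rcases t.eq_empty_or_nonempty with rfl | hne
    · simp
    · exact F.generic t ((EGInf G).isRelLowerSet_faces hs |>.2 ht hne) htn
  by_cases hinj : Function.Injective v.1
  · refine sum_zeroCount_facet b (fun k => F.toFun (v.1 k)) fun i j hij a ha hi hj => ?_
    set T : Finset (Fin (n + 2)) := (Finset.univ.erase i).erase j with hT
    have hTc : T.card = n := by
      rw [hT, Finset.card_erase_of_mem (by simp [hij.symm]),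
        Finset.card_erase_of_mem (Finset.mem_univ i)]
      simp
    have h1 := hgen (T.image v.1) (by
      intro x hx
      obtain ⟨k, -, rfl⟩ := Finset.mem_image.1 hx
      exact hv k) (by rw [Finset.card_image_of_injective _ hinj, hTc])
    rw [Finset.coe_image] at h1
    have h2 : LinearIndepOn ℝ (F.toFun ∘ v.1) (T : Set (Fin (n + 2))) :=
      h1.comp_of_image hinj.injOn
    rw [linearIndepOn_finset_iff] at h2
    have h3 : ∑ k ∈ T, a k • (F.toFun ∘ v.1) k = 0 := by
      rw [← ha]
      refine Finset.sum_subset (Finset.subset_univ T) fun k _ hk => ?_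
      have : k = j ∨ k = i := by
        by_contra h
        push Not at h
        exact hk (by simp [hT, h.1, h.2])
      rcases this with rfl | rfl <;> simp [hi, hj]
    ext k
    by_cases hk : k ∈ T
    · exact h2 a h3 k hk
    · have : k = j ∨ k = i := by
        by_contra h
        push Not at h
        exact hk (by simp [hT, h.1, h.2])
      rcases this with rfl | rfl <;> simp [hi, hj]
  · have hdeg : ∀ w : Fin (n + 1) → Vertex G, (∀ i, w i ∈ s) → ¬ Function.Injective w →
        (0 : V) ∉ convexHull ℝ (Set.range fun k => F.toFun (w k)) := by
      intro w hw hwi h0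
      obtain ⟨a, a0, a1, a2⟩ := (zero_mem_convexHull_iff _).1 h0
      set t : Finset (Vertex G) := Finset.univ.image w with ht
      have htc : t.card ≤ n := by
        have h1 : t.card ≤ n + 1 := by simpa using Finset.card_image_le (s := Finset.univ) (f := w)
        have h2 : t.card ≠ n + 1 := fun h => hwi (by
          have h3 := Finset.card_image_iff.1
            (show (Finset.univ.image w).card = (Finset.univ : Finset (Fin (n + 1))).card by
              simpa using h)
          simpa [Set.injOn_univ] using h3)
        omega
      have hts : t ⊆ s := by
        intro x hx
        obtain ⟨k, -, rfl⟩ := Finset.mem_image.1 hx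
        exact hw k
      have hl := linearIndepOn_finset_iff.1 (hgen t hts htc)
      have hmap : ∀ k ∈ (Finset.univ : Finset (Fin (n + 1))), w k ∈ t := fun k _ =>
        Finset.mem_image_of_mem w (Finset.mem_univ k)
      have hsum : ∑ x ∈ t, (∑ k with w k = x, a k) • F.toFun x = 0 := by
        rw [← a2, ← Finset.sum_fiberwise_of_maps_to hmap]
        refine Finset.sum_congr rfl fun x _ => ?_
        rw [Finset.sum_smul]
        refine Finset.sum_congr rfl fun k hk => ?_
        rw [(Finset.mem_filter.1 hk).2]
      have h3 := hl _ hsum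
      rw [← Finset.sum_fiberwise_of_maps_to hmap, Finset.sum_eq_zero h3] at a1
      exact zero_ne_one a1
    simp only [Function.Injective] at hinj
    push Not at hinj
    obtain ⟨i, j, hvij, hij⟩ := hinj
    have hrange : ∀ i j, v.1 i = v.1 j → i ≠ j → (Set.range fun k => F.toFun (v.1 (i.succAbove k))) =
        Set.range fun k => F.toFun (v.1 k) := by
      intro i j hvij hij
      ext y
      constructor
      · rintro ⟨k, rfl⟩
        exact ⟨_, rfl⟩
      · rintro ⟨k, rfl⟩
        rcases Fin.eq_self_or_eq_succAbove i k with rfl | ⟨k, rfl⟩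
        · obtain ⟨l, rfl⟩ := Fin.exists_succAbove_eq hij.symm
          exact ⟨l, by simp [hvij]⟩
        · exact ⟨k, rfl⟩
    rw [Finset.sum_eq_add_of_mem i j (Finset.mem_univ i) (Finset.mem_univ j) hij]
    · unfold zeroCount
      rw [hrange i j hvij hij, hrange j i hvij.symm hij.symm]
      by_cases h : (0 : V) ∈ convexHull ℝ (Set.range fun k => F.toFun (v.1 k))
      · rw [if_pos h, if_pos h]
        refine sign_add_sign b (fun k => F.toFun (v.1 k)) (Pi.single i 1 - Pi.single j 1) ?_ ?_ i j
          ?_ ?_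
        · simp [Finset.sum_sub_distrib]
        · simp [sub_smul, Finset.sum_sub_distrib, Pi.single_apply, hvij]
        · simp [hij]
        · simp [hij.symm]
      · simp [h]
    · intro k _ hk
      have := hdeg (fun l => v.1 (k.succAbove l)) (fun l => hv _) fun hinj => by
        obtain ⟨i', rfl⟩ := Fin.exists_succAbove_eq hk.1.symm
        obtain ⟨j', rfl⟩ := Fin.exists_succAbove_eq hk.2.symm
        exact hij (congrArg _ (hinj hvij))
      simp [zeroCount, this]

/-- The Euler class of `ρ` computed from the generic map `F`: the class in `H^n_G(EG_∞; ±ℤ)` of the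
cocycle that counts the zeros of `F` on the `n`-faces with signs. -/
noncomputable def eulerClass (ρ : Representation ℝ G V) {n : ℕ} (b : Module.Basis (Fin n) ℝ V)
    (F : GenericMap ρ n) : Cohomology (signModule ρ) (EGInf G) n :=
  cohomologyClass (signModule ρ) (EGInf G) n ⟨eulerCochain ρ b F, eulerCochain_mem_cocycles ρ b F⟩

/-- `η ∈ H^n_G(EG_∞; ±ℤ)` is the equivariant Euler class `e(V)` of the `n`-dimensional real
representation `V`, for one of the two orientations of `V`: it is represented by the cocycle that
counts with signs the zeros of a generic equivariant map `EG_∞ → V`. -/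
def IsEulerClass (ρ : Representation ℝ G V) (n : ℕ)
    (η : Cohomology (signModule ρ) (EGInf G) n) : Prop :=
  ∃ (b : Module.Basis (Fin n) ℝ V) (F : GenericMap ρ n), η = eulerClass ρ b F

end Euler

section Existence

variable {G V : Type*} [Group G] [AddCommGroup V] [Module ℝ V]

theorem exists_genericMap [Finite G] [FiniteDimensional ℝ V] (ρ : Representation ℝ G V) {n : ℕ}
    (hn : Module.finrank ℝ V = n) : Nonempty (GenericMap ρ n) := by
  classical
  cases nonempty_fintype G
  have hpick : ∀ S : Finset V, ∃ u : V, ∀ (g : G) (T : Finset V), T ⊆ S → T.card < n →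
      ρ g u ∉ Submodule.span ℝ (T : Set V) := by
    intro S
    by_contra! hcon
    let P : G × {T // T ∈ S.powerset.filter fun T => T.card < n} → Subspace ℝ V := fun x =>
      (Submodule.span ℝ (x.2.1 : Set V)).comap (ρ x.1)
    obtain ⟨⟨g, T, hT⟩, h⟩ := Subspace.exists_eq_top_of_iUnion_eq_univ (p := P) (by
      rw [Set.eq_univ_iff_forall]
      intro u
      obtain ⟨g, T, hTS, hTn, hu⟩ := hcon u
      exact Set.mem_iUnion.2 ⟨(g, ⟨T, by simp [hTS, hTn]⟩), hu⟩)
    have htop : Submodule.span ℝ (T : Set V) = ⊤ := by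
      rw [eq_top_iff]
      intro y _
      have h1 : ρ g⁻¹ y ∈ P (g, ⟨T, hT⟩) := by rw [h]; trivial
      have h2 : ρ g (ρ g⁻¹ y) ∈ Submodule.span ℝ (T : Set V) := h1
      rwa [← Module.End.mul_apply, ← map_mul, mul_inv_cancel, map_one] at h2
    have h3 := finrank_span_finset_le_card (R := ℝ) T
    rw [Set.finrank, htop, finrank_top, hn] at h3
    have h4 := (Finset.mem_filter.1 hT).2
    omega
  choose pick hpick using hpick
  let L : ℕ → Finset V := fun k => Nat.rec ∅
    (fun _ S => S ∪ Finset.univ.image fun g : G => ρ g (pick S)) k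
  have hL : ∀ k, L (k + 1) = L k ∪ Finset.univ.image fun g : G => ρ g (pick (L k)) := fun _ => rfl
  have hmono : Monotone L := monotone_nat_of_le_succ fun k => by
    rw [hL]; exact Finset.subset_union_left
  refine ⟨⟨fun x => ρ x.elt (pick (L x.index)), fun g x => ?_, fun s hs hsn => ?_⟩⟩
  · change ρ (g * x.elt) _ = _
    rw [map_mul]
    rfl
  · have hs' := hs.2.2
    clear hs
    induction s using Finset.induction_on_max_value (fun x : Vertex G => x.index) with
    | empty => simp
    | insert x s hx hmax ih =>
      rw [Finset.card_insert_of_notMem hx] at hsn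
      rw [Finset.coe_insert]
      refine (ih (by omega) fun y hy z hz => hs' y (Finset.mem_insert_of_mem hy) z
        (Finset.mem_insert_of_mem hz)).insert ?_
      rw [← Finset.coe_image]
      refine hpick (L x.index) x.elt _ ?_ (lt_of_le_of_lt Finset.card_image_le (by omega))
      intro y hy
      obtain ⟨z, hz, rfl⟩ := Finset.mem_image.1 hy
      have hlt : z.index < x.index := lt_of_le_of_ne (hmax z hz) fun h =>
        hx (hs' z (Finset.mem_insert_of_mem hz) x (Finset.mem_insert_self x s) h ▸ hz)
      refine hmono (Nat.succ_le_of_lt hlt) ?_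
      rw [Nat.succ_eq_add_one, hL]
      exact Finset.mem_union_right _ (Finset.mem_image_of_mem _ (Finset.mem_univ z.elt))

/-- Every `n`-dimensional real representation of a finite group has an Euler class. -/
theorem exists_isEulerClass [Finite G] [FiniteDimensional ℝ V] (ρ : Representation ℝ G V) {n : ℕ}
    (hn : Module.finrank ℝ V = n) : ∃ η, IsEulerClass ρ n η :=
  let ⟨F⟩ := exists_genericMap ρ hn
  ⟨_, Module.finBasisOfFinrankEq ℝ V hn, F, rfl⟩

end Existence

end EulerJoin

/-! The Euler class can be computed from any generic map, and changing the sign of a generic map `F`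
on whole factors of the join gives another one. For a subset `S` of the indices `0, …, N` let
`F.flip S` be `F` negated on the factors in `S`. All these `2 ^ (N + 1)` maps agree with `F` on the
factors beyond `N`, and this forces their Euler cocycles to be cohomologous on `Z`. Indeed, shifting
a vertex of `EG G N` by `N + 1` factors is contiguous, inside `EGInf G`, to the inclusion, so each
restricted cocycle is cohomologous to its pullback along the shift, which sees only the values
beyond `N` (`restrictCochain_eulerCochain_sub_mem`). The chain homotopy is the classical prism
operator.

Now fix an `n`-face. Genericity makes every nontrivial linear relation among its `n + 1` values have
no zero coefficient, so up to scale there is at most one. The flipped map has a zero on the face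
only if the flipped signs turn this relation into a positive one, which leaves at most two of the `2
^ (n + 1)` sign patterns. Hence at most a fraction `2 ^ (-n)` of all `S` is bad for the face
(`GenericMap.card_flip_mul_le`), and by equivariance the bad sets depend only on the orbit of the
face.

With fewer than `2 ^ n` orbits of `n`-faces the bad sets cannot cover all `S`. A remaining `S` gives
a cocycle that vanishes identically on `Z`, so the restricted Euler class is zero. -/

namespace EulerJoin

/-! ### Contiguous maps induce the same map in cohomology -/

section Prism

variable {α β : Type*}

/-- The sequence `p` without its `j`-th term. -/
def omitTerm (j : ℕ) (p : ℕ → α) : ℕ → α := fun k => p (if k < j then k else k + 1)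

/-- The sequence `f (p 0), …, f (p i), g (p i), g (p (i + 1)), …`. -/
def prism (f g : α → β) (i : ℕ) (p : ℕ → α) : ℕ → β :=
  fun k => if k ≤ i then f (p k) else g (p (k - 1))

/-- The sequence `f (p 0), …, f (p (i - 1)), g (p i), g (p (i + 1)), …`. -/
def splice (f g : α → β) (i : ℕ) (p : ℕ → α) : ℕ → β :=
  fun k => if k < i then f (p k) else g (p k)

/-- The facets of the simplices of a prism come in four kinds: this lemma and the next give the
lateral ones, which are prisms over facets of the base; the last two give the interior walls shared
by neighbouring simplices, with the two ends as extreme cases. Sequences indexed by `ℕ` reduce each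
identity to a case split on indices. -/
theorem omitTerm_prism_of_lt (f g : α → β) {i j : ℕ} (h : j < i + 1) (p : ℕ → α) :
    omitTerm j (prism f g (i + 1) p) = prism f g i (omitTerm j p) := by
  funext k
  simp only [omitTerm, prism]
  split_ifs <;> first | omega | rfl | (congr 2; omega)

theorem omitTerm_prism_of_gt (f g : α → β) {i j : ℕ} (h : i < j) (p : ℕ → α) :
    omitTerm (j + 1) (prism f g i p) = prism f g i (omitTerm j p) := by
  funext k
  simp only [omitTerm, prism]
  split_ifs <;> first | omega | rfl | (congr 2; omega)

theorem omitTerm_prism_self (f g : α → β) (i : ℕ) (p : ℕ → α) :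
    omitTerm i (prism f g i p) = splice f g i p := by
  funext k
  unfold omitTerm prism splice
  split_ifs <;> first | omega | rfl

theorem omitTerm_prism_succ (f g : α → β) (i : ℕ) (p : ℕ → α) :
    omitTerm (i + 1) (prism f g i p) = splice f g (i + 1) p := by
  funext k
  unfold omitTerm prism splice
  split_ifs <;> first | omega | rfl

open Finset in
/-- The alternating sum over the facets of all simplices of a prism. -/
theorem sum_prism {A : Type*} [AddCommGroup A] (D E : ℕ → ℕ → A) (W : ℕ → A) (m : ℕ)
    (hlt : ∀ i j, j < i + 1 → D (i + 1) j = E i j) (hgt : ∀ i j, i < j → D i (j + 1) = E i j)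
    (hself : ∀ i, D i i = W i) (hsucc : ∀ i, D i (i + 1) = W (i + 1)) :
    ∑ i ∈ range (m + 1), ∑ j ∈ range (m + 2), (-1 : ℤ) ^ (i + j) • D i j =
      W 0 - W (m + 1) - ∑ j ∈ range (m + 1), ∑ i ∈ range m, (-1 : ℤ) ^ (i + j) • E i j := by
  -- Row `i` splits at the diagonal. Entries left of it stay as they are, the two middle ones give a
  -- telescoping difference, and those right of it are reindexed by `j ↦ j + 1`, which reverses
  -- their sign.
  have row : ∀ i ∈ range (m + 1), ∑ j ∈ range (m + 2), (-1 : ℤ) ^ (i + j) • D i j =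
      ∑ j ∈ range i, (-1 : ℤ) ^ (i + j) • D i j + (W i - W (i + 1)) -
        ∑ j ∈ Ico (i + 1) (m + 1), (-1 : ℤ) ^ (i + j) • E i j := by
    intro i hi
    have hi' : i ≤ m := by simpa [Nat.lt_succ_iff] using hi
    rw [← sum_range_add_sum_Ico _ (show i + 2 ≤ m + 2 by omega), sum_range_succ, sum_range_succ,
      hself, hsucc, sum_Ico_eq_sum_range, sum_Ico_eq_sum_range, ← sub_eq_zero]
    have : ∑ k ∈ range (m + 2 - (i + 2)), (-1 : ℤ) ^ (i + (i + 2 + k)) • D i (i + 2 + k) =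
        - ∑ k ∈ range (m + 1 - (i + 1)), (-1 : ℤ) ^ (i + (i + 1 + k)) • E i (i + 1 + k) := by
      rw [← sum_neg_distrib, show m + 2 - (i + 2) = m + 1 - (i + 1) by omega]
      refine sum_congr rfl fun k _ => ?_
      rw [show i + 2 + k = (i + 1 + k) + 1 by omega, hgt i (i + 1 + k) (by omega), ← neg_smul]
      congr 1
      ring
    rw [this]
    have e : (-1 : ℤ) ^ (i + i) = 1 := Even.neg_one_pow ⟨i, rfl⟩
    have e' : (-1 : ℤ) ^ (i + (i + 1)) = -1 := by rw [← add_assoc, pow_succ, e, one_mul]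
    rw [e, e', one_smul, neg_one_smul]
    abel
  -- The walls telescope to the two ends. Row `0` has no left part and row `m` no right part;
  -- peeling them off leaves two sums over `range m` that together fill the rectangle of all `E i
  -- j`.
  rw [sum_congr rfl row, sum_sub_distrib, sum_add_distrib, sum_range_sub', sum_range_succ',
    sum_range_succ (fun i => ∑ j ∈ Ico (i + 1) (m + 1), (-1 : ℤ) ^ (i + j) • E i j),
    sum_comm (s := range (m + 1))]
  have : ∑ i ∈ range m, ∑ j ∈ range (m + 1), (-1 : ℤ) ^ (i + j) • E i j =
      - ∑ i ∈ range m, ∑ j ∈ range (i + 1), (-1 : ℤ) ^ (i + 1 + j) • D (i + 1) j +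
        ∑ i ∈ range m, ∑ j ∈ Ico (i + 1) (m + 1), (-1 : ℤ) ^ (i + j) • E i j := by
    rw [← sum_neg_distrib, ← sum_add_distrib]
    refine sum_congr rfl fun i hi => ?_
    rw [← sum_range_add_sum_Ico _ (show i + 1 ≤ m + 1 by have := mem_range.1 hi; omega),
      ← sum_neg_distrib]
    congr 1
    refine sum_congr rfl fun j hj => ?_
    rw [hlt i j (mem_range.1 hj), ← neg_smul]
    congr 1
    ring
  rw [this]
  simp only [range_zero, sum_empty, Ico_self, add_zero]
  abel

end Prism

/-! ### Pullbacks of equivariant cochains and the prism homotopy -/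

section Contiguity

variable {G α β A : Type*} [Group G] [MulAction G α] [MulAction G β] [AddCommGroup A]
  {τ : Representation ℤ G A}
  {X : PreAbstractSimplicialComplex β} {Y : PreAbstractSimplicialComplex α}

/-- The pullback of cochains along an equivariant simplicial map. -/
def pullbackCochain (τ : Representation ℤ G A) (f : α → β) (hf : ∀ (g : G) x, f (g • x) = g • f x)
    (hXY : ∀ s ∈ Y.faces, ∃ t ∈ X.faces, ∀ x ∈ s, f x ∈ t) (n : ℕ) (c : cochains τ X n) :
    cochains τ Y n :=
  ⟨fun v => c.1 ⟨fun i => f (v.1 i), by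
      obtain ⟨s, hs, hv⟩ := v.2
      obtain ⟨t, ht, hst⟩ := hXY s hs
      exact ⟨t, ht, fun i => hst _ (hv i)⟩⟩,
    fun g v w h => c.2 g _ _ fun i => by simp only [h i, hf]⟩

open Classical in
/-- The value of a cochain on the first `n + 1` terms of a sequence of vertices, or zero if these
terms are not contained in a face. -/
noncomputable def cochainValue {n : ℕ} (c : cochains τ X n) (p : ℕ → β) : A :=
  if h : ∃ s ∈ X.faces, ∀ i : Fin (n + 1), p i ∈ s then c.1 ⟨fun i => p i, h⟩ else 0

theorem cochainValue_eq {n : ℕ} (c : cochains τ X n) {p : ℕ → β} (v : Simplex X n)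
    (h : ∀ i : Fin (n + 1), p i = v.1 i) : cochainValue c p = c.1 v := by
  have hv : (fun i : Fin (n + 1) => p i) = v.1 := funext h
  have : ∃ s ∈ X.faces, ∀ i : Fin (n + 1), p i ∈ s := by
    obtain ⟨s, hs, hs'⟩ := v.2
    exact ⟨s, hs, fun i => h i ▸ hs' i⟩
  rw [cochainValue, dif_pos this]
  exact congrArg c.1 (Subtype.ext hv)

theorem cochainValue_congr {n : ℕ} (c : cochains τ X n) {p q : ℕ → β}
    (h : ∀ i ≤ n, p i = q i) : cochainValue c p = cochainValue c q := by
  by_cases hp : ∃ s ∈ X.faces, ∀ i : Fin (n + 1), p i ∈ s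
  · rw [cochainValue_eq c ⟨_, hp⟩ fun _ => rfl]
    exact (cochainValue_eq c ⟨_, hp⟩ fun i => (h i (by omega)).symm).symm
  · have hq : ¬ ∃ s ∈ X.faces, ∀ i : Fin (n + 1), q i ∈ s := by
      rintro ⟨s, hs, hqs⟩
      exact hp ⟨s, hs, fun i => by rw [h i (by omega)]; exact hqs i⟩
    rw [cochainValue, cochainValue, dif_neg hp, dif_neg hq]

theorem cochainValue_smul {n : ℕ} (c : cochains τ X n) {p q : ℕ → β} (g : G)
    (hp : ∃ s ∈ X.faces, ∀ i : Fin (n + 1), p i ∈ s)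
    (hq : ∃ s ∈ X.faces, ∀ i : Fin (n + 1), q i ∈ s) (h : ∀ i ≤ n, q i = g • p i) :
    cochainValue c q = τ g (cochainValue c p) := by
  rw [cochainValue_eq c ⟨_, hp⟩ fun _ => rfl, cochainValue_eq c ⟨_, hq⟩ fun _ => rfl]
  exact c.2 g _ _ fun i => h i (by omega)

/-- The cocycle condition in the language of sequences; the hypothesis on `p` ensures that none of
the terms is the default value zero of `cochainValue`. -/
theorem sum_cochainValue_omitTerm {n : ℕ} {c : cochains τ X n} (hc : c ∈ cocycles τ X n)
    {p : ℕ → β} (hp : ∃ s ∈ X.faces, ∀ i : Fin (n + 2), p i ∈ s) :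
    ∑ j ∈ Finset.range (n + 2), (-1 : ℤ) ^ j • cochainValue c (omitTerm j p) = 0 := by
  have h0 : coboundary τ X n c = 0 := hc
  have h1 := congrArg (fun c => c.1 ⟨fun i => p i, hp⟩) h0
  refine Eq.trans ?_ h1
  rw [← Fin.sum_univ_eq_sum_range (fun j => (-1 : ℤ) ^ j • cochainValue c (omitTerm j p))]
  refine Finset.sum_congr rfl fun j _ => ?_
  rw [cochainValue_eq c (Simplex.facet ⟨fun i => p i, hp⟩ j)]
  intro k
  simp only [omitTerm, Simplex.facet]
  congr 1
  rw [Fin.succAbove]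
  simp only [Fin.lt_def, Fin.val_castSucc]
  split_ifs <;> simp

/-- The sequence of vertices of an ordered simplex, continued periodically. -/
def Simplex.seq {n : ℕ} (v : Simplex Y n) : ℕ → α := fun k => v.1 (Fin.ofNat (n + 1) k)

theorem Simplex.seq_val {n : ℕ} (v : Simplex Y n) (i : Fin (n + 1)) : v.seq i = v.1 i := by
  simp [Simplex.seq]

theorem prism_mem_face {f g : α → β}
    (hfg : ∀ s ∈ Y.faces, ∃ t ∈ X.faces, ∀ x ∈ s, f x ∈ t ∧ g x ∈ t) {n : ℕ} (v : Simplex Y n)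
    (i : ℕ) : ∃ t ∈ X.faces, ∀ k, prism f g i v.seq k ∈ t := by
  obtain ⟨s, hs, hv⟩ := v.2
  obtain ⟨t, ht, hst⟩ := hfg s hs
  refine ⟨t, ht, fun k => ?_⟩
  unfold prism
  split_ifs
  exacts [(hst _ (hv _)).1, (hst _ (hv _)).2]

/-- The chain homotopy between the pullbacks along two contiguous maps. -/
noncomputable def prismCochain (f g : α → β) (hf : ∀ (a : G) x, f (a • x) = a • f x)
    (hg : ∀ (a : G) x, g (a • x) = a • g x)
    (hfg : ∀ s ∈ Y.faces, ∃ t ∈ X.faces, ∀ x ∈ s, f x ∈ t ∧ g x ∈ t) {n : ℕ}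
    (c : cochains τ X (n + 1)) : cochains τ Y n :=
  ⟨fun v => ∑ i ∈ Finset.range (n + 1), (-1 : ℤ) ^ i • cochainValue c (prism f g i v.seq), by
    intro a v w h
    simp only [map_sum, map_zsmul]
    refine Finset.sum_congr rfl fun i _ => ?_
    obtain ⟨s, hs, hv⟩ := prism_mem_face hfg v i
    obtain ⟨t, ht, hw⟩ := prism_mem_face hfg w i
    rw [cochainValue_smul c a ⟨s, hs, fun k => hv k⟩ ⟨t, ht, fun k => hw k⟩]
    intro k _
    unfold prism
    split_ifs
    · exact (congrArg f (h _)).trans (hf _ _)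
    · exact (congrArg g (h _)).trans (hg _ _)⟩

/-- On a cocycle the homotopy formula `d P + P d = g^* - f^*` loses its second term. The surviving
identity is `sum_prism` with `D` the facets of the prism simplices, `E` the prisms over the facets
and `W` the walls. -/
theorem coboundary_prismCochain (f g : α → β) (hf : ∀ (a : G) x, f (a • x) = a • f x)
    (hg : ∀ (a : G) x, g (a • x) = a • g x)
    (hfg : ∀ s ∈ Y.faces, ∃ t ∈ X.faces, ∀ x ∈ s, f x ∈ t ∧ g x ∈ t) {n : ℕ}
    {c : cochains τ X (n + 1)} (hc : c ∈ cocycles τ X (n + 1)) :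
    coboundary τ Y n (prismCochain f g hf hg hfg c) =
      pullbackCochain τ g hg (fun s hs => (hfg s hs).imp fun _ h => ⟨h.1, fun x hx => (h.2 x hx).2⟩)
          (n + 1) c -
        pullbackCochain τ f hf
          (fun s hs => (hfg s hs).imp fun _ h => ⟨h.1, fun x hx => (h.2 x hx).1⟩) (n + 1) c := by
  refine Subtype.ext (funext fun v => ?_)
  have key := sum_prism (fun i j => cochainValue c (omitTerm j (prism f g i v.seq)))
    (fun i j => cochainValue c (prism f g i (omitTerm j v.seq)))
    (fun i => cochainValue c (splice f g i v.seq)) (n + 1)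
    (fun i j h => by simp only [omitTerm_prism_of_lt f g h])
    (fun i j h => by simp only [omitTerm_prism_of_gt f g h])
    (fun i => by simp only [omitTerm_prism_self]) (fun i => by simp only [omitTerm_prism_succ])
  -- Each row of the double sum is the cocycle condition on one simplex of the prism, so the left
  -- side vanishes.
  rw [Finset.sum_eq_zero] at key
  · have key' := sub_eq_zero.1 key.symm
    refine Eq.trans ?_ (key'.symm.trans (congrArg₂ (· - ·) ?_ ?_))
    · rw [← Fin.sum_univ_eq_sum_range (fun j => ∑ i ∈ Finset.range (n + 1), (-1 : ℤ) ^ (i + j) •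
        cochainValue c (prism f g i (omitTerm j v.seq)))]
      change ∑ j : Fin (n + 2), (-1 : ℤ) ^ (j : ℕ) • ∑ i ∈ Finset.range (n + 1),
        (-1 : ℤ) ^ i • cochainValue c (prism f g i (v.facet j).seq) = _
      refine Finset.sum_congr rfl fun j _ => ?_
      rw [Finset.smul_sum]
      refine Finset.sum_congr rfl fun i hi => ?_
      have hi := Finset.mem_range.1 hi
      rw [smul_smul, ← pow_add, add_comm (j : ℕ) i]
      congr 1
      refine cochainValue_congr c fun k hk => ?_
      have hseq : ∀ l ≤ n, (v.facet j).seq l = omitTerm j v.seq l := by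
        intro l hl
        have e := (v.facet j).seq_val ⟨l, by omega⟩
        rw [e]
        change v.1 (j.succAbove ⟨l, by omega⟩) = _
        rw [← v.seq_val]
        unfold omitTerm
        congr 1
        rw [Fin.succAbove]
        simp only [Fin.lt_def, Fin.val_castSucc]
        split_ifs <;> rfl
      unfold prism
      split_ifs
      · rw [hseq k (by omega)]
      · rw [hseq (k - 1) (by omega)]
    · refine cochainValue_eq c _ fun i => ?_
      simp [splice, v.seq_val]
    · refine cochainValue_eq c _ fun i => ?_
      have : (i : ℕ) < n + 1 + 1 := i.2
      simp [splice, v.seq_val, this]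
  · intro i _
    obtain ⟨t, ht, h⟩ := prism_mem_face hfg v i
    simp only [pow_add, mul_smul]
    rw [← Finset.smul_sum, sum_cochainValue_omitTerm hc ⟨t, ht, fun k => h k⟩, smul_zero]

/-- Contiguous maps have cohomologous pullbacks. -/
theorem pullbackCochain_sub_mem_coboundaries (f g : α → β)
    (hf : ∀ (a : G) x, f (a • x) = a • f x) (hg : ∀ (a : G) x, g (a • x) = a • g x)
    (hfg : ∀ s ∈ Y.faces, ∃ t ∈ X.faces, ∀ x ∈ s, f x ∈ t ∧ g x ∈ t) {n : ℕ}
    {c : cochains τ X n} (hc : c ∈ cocycles τ X n) :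
    pullbackCochain τ g hg (fun s hs => (hfg s hs).imp fun _ h => ⟨h.1, fun x hx => (h.2 x hx).2⟩)
        n c -
      pullbackCochain τ f hf
        (fun s hs => (hfg s hs).imp fun _ h => ⟨h.1, fun x hx => (h.2 x hx).1⟩) n c ∈
      coboundaries τ Y n := by
  cases n with
  | succ n => exact ⟨_, coboundary_prismCochain f g hf hg hfg hc⟩
  | zero =>
    -- In degree zero the pullbacks must be equal. The prism over a vertex `x` is the edge from `f
    -- x` to `g x`, and the cocycle condition on it equates the two values.
    refine (AddSubgroup.mem_bot).2 (Subtype.ext (funext fun v => ?_))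
    obtain ⟨t, ht, h⟩ := prism_mem_face hfg v 0
    have h0 := sum_cochainValue_omitTerm hc (p := prism f g 0 v.seq) ⟨t, ht, fun k => h k⟩
    rw [Finset.sum_range_succ, Finset.sum_range_one, omitTerm_prism_self, omitTerm_prism_succ,
      pow_zero, pow_one, one_smul, neg_one_smul, ← sub_eq_add_neg] at h0
    refine (congrArg₂ (· - ·) ?_ ?_).symm.trans h0
    · exact cochainValue_eq c _ fun i => congrArg g (v.seq_val i)
    · refine cochainValue_eq c _ fun i => (if_pos (by omega)).trans (congrArg f (v.seq_val i))

end Contiguity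


/-! ### Finiteness of the finite joins -/

section Finiteness

theorem finite_faces_EG (G : Type*) [Finite G] (N : ℕ) : (EG G N).faces.Finite := by
  have hv : {x : Vertex G | x.index ≤ N}.Finite := by
    refine Set.Finite.of_finite_image (f := fun x : Vertex G => (x.index, x.elt)) ?_ ?_
    · refine ((Set.finite_Iic N).prod (Set.finite_univ (α := G))).subset ?_
      rintro _ ⟨x, hx, rfl⟩
      exact ⟨hx, trivial⟩
    · intro x _ y _ h
      exact Vertex.ext (congrArg Prod.fst h) (congrArg Prod.snd h)
  refine (Set.Finite.finite_subsets hv).preimage Finset.coe_injective.injOn |>.subset ?_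
  intro s hs x hx
  exact hs.2.1 x hx

end Finiteness

/-! ### Sign changes of generic maps and their zeros on a face -/

section Generic

variable {G V : Type*} [Group G] [AddCommGroup V] [Module ℝ V]

theorem sum_equivFin_symm {ι M : Type*} [AddCommMonoid M] (s : Finset ι) (q : ι → M) :
    ∑ k : Fin s.card, q (s.equivFin.symm k) = ∑ x ∈ s, q x := by
  rw [s.equivFin.symm.sum_comp (fun x : s => q x), Finset.sum_coe_sort]

/-- Zero is in the hull of finitely many points iff it is a convex combination. -/
theorem zero_mem_convexHull_image_iff {ι : Type*} (p : ι → V) (s : Finset ι) :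
    (0 : V) ∈ convexHull ℝ (p '' s) ↔
      ∃ a : ι → ℝ, (∀ x ∈ s, 0 ≤ a x) ∧ ∑ x ∈ s, a x = 1 ∧ ∑ x ∈ s, a x • p x = 0 := by
  classical
  have hr : p '' (s : Set ι) = Set.range fun k : Fin s.card => p (s.equivFin.symm k) := by
    ext y
    constructor
    · rintro ⟨x, hx, rfl⟩
      exact ⟨s.equivFin ⟨x, hx⟩, by simp⟩
    · rintro ⟨k, rfl⟩
      exact ⟨_, (s.equivFin.symm k).2, rfl⟩
  rw [hr, zero_mem_convexHull_iff]
  constructor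
  · rintro ⟨a, h0, h1, h2⟩
    refine ⟨fun x => if hx : x ∈ s then a (s.equivFin ⟨x, hx⟩) else 0, fun x hx => ?_, ?_, ?_⟩
    · simp [hx, h0]
    · rw [← sum_equivFin_symm, ← h1]
      simp
    · rw [← sum_equivFin_symm, ← h2]
      simp
  · rintro ⟨a, h0, h1, h2⟩
    refine ⟨fun k => a (s.equivFin.symm k), fun k => h0 _ (s.equivFin.symm k).2, ?_, ?_⟩
    · rw [sum_equivFin_symm s a, h1]
    · rw [sum_equivFin_symm s fun x => a x • p x, h2]

/-- The sign `-1` for the elements of `S`, and `1` for the other natural numbers. -/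
def flipSign (S : Finset ℕ) (k : ℕ) : ℝ := if k ∈ S then -1 else 1

theorem flipSign_ne_zero (S : Finset ℕ) (k : ℕ) : flipSign S k ≠ 0 := by
  unfold flipSign
  split_ifs <;> norm_num

variable {ρ : Representation ℝ G V} {n : ℕ}

/-- Change the sign of a generic map on the factors of the join with indices in `S`. -/
def GenericMap.flip (F : GenericMap ρ n) (S : Finset ℕ) : GenericMap ρ n where
  toFun x := flipSign S x.index • F.toFun x
  equivariant g x := by
    rw [F.equivariant, map_smul]
    rfl
  generic s hs hsn := by
    have h := linearIndepOn_finset_iff.1 (F.generic s hs hsn)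
    refine linearIndepOn_finset_iff.2 fun a ha x hx => ?_
    simp only [smul_smul] at ha
    exact (mul_eq_zero.1 (h (fun x => a x * flipSign S x.index) ha x hx)).resolve_right
      (flipSign_ne_zero S _)

theorem GenericMap.zero_notMem_convexHull (F : GenericMap ρ n) {s : Finset (Vertex G)}
    (hs : s ∈ (EGInf G).faces) (hsn : s.card ≤ n) :
    (0 : V) ∉ convexHull ℝ (F.toFun '' (s : Set (Vertex G))) := by
  rw [zero_mem_convexHull_image_iff]
  rintro ⟨a, -, h1, h2⟩
  have h := linearIndepOn_finset_iff.1 (F.generic s hs hsn) a h2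
  rw [Finset.sum_eq_zero h] at h1
  exact zero_ne_one h1

/-- A relation between the values on an `n`-face which does not involve all vertices is trivial. -/
theorem GenericMap.relation_eq_zero (F : GenericMap ρ n) {s : Finset (Vertex G)}
    (hs : s ∈ (EGInf G).faces) (hsn : s.card = n + 1) {a : Vertex G → ℝ}
    (ha : ∑ x ∈ s, a x • F.toFun x = 0) {y : Vertex G} (hy : y ∈ s) (hay : a y = 0) :
    ∀ x ∈ s, a x = 0 := by
  classical
  have hc : (s.erase y).card = n := by rw [Finset.card_erase_of_mem hy, hsn]; rfl
  have hli : LinearIndepOn ℝ F.toFun ((s.erase y : Finset _) : Set (Vertex G)) := by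
    rcases (s.erase y).eq_empty_or_nonempty with h | h
    · rw [h]; simp
    · exact F.generic _ ((EGInf G).isRelLowerSet_faces hs |>.2 (Finset.erase_subset y s) h) hc.le
  have h0 : ∑ x ∈ s.erase y, a x • F.toFun x = 0 := by
    rw [← ha, ← Finset.add_sum_erase s _ hy, hay, zero_smul, zero_add]
  intro x hx
  by_cases hxy : x = y
  · rw [hxy, hay]
  · exact linearIndepOn_finset_iff.1 hli a h0 x (Finset.mem_erase.2 ⟨hxy, hx⟩)

/-- If two sign changes of a generic map have a zero in the same `n`-face and agree at one vertex of
this face, then they agree on the face. -/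
theorem GenericMap.mem_iff_of_zero_mem_flip (F : GenericMap ρ n) {s : Finset (Vertex G)}
    (hs : s ∈ (EGInf G).faces) (hsn : s.card = n + 1) {S T : Finset ℕ}
    (hS : (0 : V) ∈ convexHull ℝ ((F.flip S).toFun '' (s : Set (Vertex G))))
    (hT : (0 : V) ∈ convexHull ℝ ((F.flip T).toFun '' (s : Set (Vertex G))))
    {y : Vertex G} (hy : y ∈ s) (hyST : y.index ∈ S ↔ y.index ∈ T) :
    ∀ x ∈ s, (x.index ∈ S ↔ x.index ∈ T) := by
  rw [zero_mem_convexHull_image_iff] at hS hT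
  obtain ⟨a, a0, a1, a2⟩ := hS
  obtain ⟨c, c0, c1, c2⟩ := hT
  -- A vanishing coefficient would kill the whole relation, although its coefficients sum to `1`.
  have pos : ∀ (U : Finset ℕ) (e : Vertex G → ℝ), (∀ x ∈ s, 0 ≤ e x) → ∑ x ∈ s, e x = 1 →
      ∑ x ∈ s, e x • (F.flip U).toFun x = 0 → ∀ x ∈ s, 0 < e x := by
    intro U e e0 e1 e2 x hx
    refine lt_of_le_of_ne (e0 x hx) fun h => ?_
    rw [Finset.sum_eq_zero ((F.flip U).relation_eq_zero hs hsn e2 hx h.symm)] at e1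
    exact zero_ne_one e1
  have apos := pos S a a0 a1 a2
  have cpos := pos T c c0 c1 c2
  -- The combination of the two relations whose coefficient at `y` cancels. It is therefore trivial,
  -- and since all of `a` and `c` are positive, the signs must match at every vertex.
  have hrel : ∑ x ∈ s, (c y * (a x * flipSign S x.index) - a y * (c x * flipSign T x.index)) •
      F.toFun x = 0 := by
    simp only [sub_smul, Finset.sum_sub_distrib, mul_smul, ← Finset.smul_sum]
    change c y • ∑ x ∈ s, a x • (F.flip S).toFun x - a y • ∑ x ∈ s, c x • (F.flip T).toFun x = 0
    rw [a2, c2, smul_zero, smul_zero, sub_zero]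
  have hy0 : flipSign S y.index = flipSign T y.index := by simp [flipSign, hyST]
  intro x hx
  have h := F.relation_eq_zero hs hsn hrel hy (by rw [hy0]; ring) x hx
  have hp := mul_pos (cpos y hy) (apos x hx)
  have hq := mul_pos (apos y hy) (cpos x hx)
  unfold flipSign at h
  split_ifs at h with h1 h2 h2
  · simp [h1, h2]
  · nlinarith
  · nlinarith
  · simp [h1, h2]

open Classical in
/-- At most `2 ^ (m - n)` of the `2 ^ m` sign changes of a generic map have a zero in a given
`n`-face. -/
theorem GenericMap.card_flip_mul_le (F : GenericMap ρ n) {s : Finset (Vertex G)}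
    (hs : s ∈ (EGInf G).faces) (hsn : s.card = n + 1) {I : Finset ℕ} (hI : ∀ x ∈ s, x.index ∈ I) :
    (I.powerset.filter fun S =>
      (0 : V) ∈ convexHull ℝ ((F.flip S).toFun '' (s : Set (Vertex G)))).card * 2 ^ n ≤
      2 ^ I.card := by
  obtain ⟨y, hy⟩ := hs.1
  set J : Finset ℕ := (s.erase y).image Vertex.index with hJ
  have hinj : Set.InjOn Vertex.index (s : Set (Vertex G)) := fun x hx z hz => hs.2.2 x hx z hz
  have hJc : J.card = n := by
    rw [hJ, Finset.card_image_of_injOn (hinj.mono (by simp)), Finset.card_erase_of_mem hy, hsn]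
    rfl
  have hyJ : y.index ∉ J := by
    intro h
    obtain ⟨x, hx, hxy⟩ := Finset.mem_image.1 h
    exact Finset.ne_of_mem_erase hx (hinj (Finset.mem_of_mem_erase hx) hy hxy)
  have hJI : J ⊆ I := by
    intro k hk
    obtain ⟨x, hx, rfl⟩ := Finset.mem_image.1 hk
    exact hI x (Finset.mem_of_mem_erase hx)
  have hp : 2 ^ n = J.powerset.card := by rw [Finset.card_powerset, hJc]
  rw [hp, ← Finset.card_powerset I, ← Finset.card_product]
  -- Toggling a bad `S` by subsets `T` of the `n` indices in `J` never produces the same set twice.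
  -- Outside `J`, and in particular at `y`, the set `S` can be read off from the result; the
  -- agreement at `y` then determines `S` on `J`.
  refine Finset.card_le_card_of_injOn (fun P => symmDiff P.1 P.2) ?_ ?_
  · rintro ⟨S, T⟩ h
    simp only [Finset.coe_product, Set.mem_prod, Finset.mem_coe, Finset.mem_filter,
      Finset.mem_powerset] at h
    rw [Finset.mem_coe, Finset.mem_powerset]
    intro k hk
    rcases Finset.mem_symmDiff.1 hk with h' | h'
    · exact h.1.1 h'.1
    · exact hJI (h.2 h'.1)
  · rintro ⟨S, T⟩ h ⟨S', T'⟩ h' heq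
    simp only [Finset.coe_product, Set.mem_prod, Finset.mem_coe, Finset.mem_filter,
      Finset.mem_powerset] at h h'
    have heq' : ∀ k, (k ∈ symmDiff S T ↔ k ∈ symmDiff S' T') := fun k => by
      rw [show symmDiff S T = symmDiff S' T' from heq]
    simp only [Finset.mem_symmDiff] at heq'
    have hSS : S = S' := by
      ext k
      by_cases hk : k ∈ J
      · obtain ⟨x, hx, rfl⟩ := Finset.mem_image.1 hk
        refine F.mem_iff_of_zero_mem_flip hs hsn h.1.2 h'.1.2 hy ?_ x (Finset.mem_of_mem_erase hx)
        have h1 : y.index ∉ T := fun hh => hyJ (h.2 hh)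
        have h2 : y.index ∉ T' := fun hh => hyJ (h'.2 hh)
        simpa [h1, h2] using heq' y.index
      · have h1 : k ∉ T := fun hh => hk (h.2 hh)
        have h2 : k ∉ T' := fun hh => hk (h'.2 hh)
        simpa [h1, h2] using heq' k
    subst hSS
    exact Prod.ext rfl (symmDiff_right_injective S heq)

end Generic

/-! ### Independence of the sign change, and counting orbits -/

section Shift

variable {G V : Type*} [Group G] [AddCommGroup V] [Module ℝ V] {ρ : Representation ℝ G V} {n : ℕ}

/-- Move a vertex of the join by `m` factors. -/
def Vertex.shift (m : ℕ) (x : Vertex G) : Vertex G := ⟨x.index + m, x.elt⟩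

/-- The restriction of the Euler cocycle to a subcomplex of `EG_N` depends, up to coboundaries, only
on the values of the generic map on the other factors of the join. -/
theorem restrictCochain_eulerCochain_sub_mem (b : Module.Basis (Fin n) ℝ V) {N : ℕ}
    {Z : PreAbstractSimplicialComplex (Vertex G)} (hZ : Z ≤ EG G N) (F F' : GenericMap ρ n)
    (h : ∀ x : Vertex G, N < x.index → F.toFun x = F'.toFun x) :
    restrictCochain (signModule ρ) (hZ.trans (EG_le_EGInf G N)) n (eulerCochain ρ b F) -
      restrictCochain (signModule ρ) (hZ.trans (EG_le_EGInf G N)) n (eulerCochain ρ b F') ∈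
      coboundaries (signModule ρ) Z n := by
  classical
  -- A face and its shifted copy use disjoint sets of factors, with indices at most `N` and above
  -- `N`, so their union is again a face.
  have hfg : ∀ s ∈ Z.faces, ∃ t ∈ (EGInf G).faces, ∀ x ∈ s,
      x.shift (N + 1) ∈ t ∧ id x ∈ t := by
    intro s hs
    have hs' := hZ hs
    refine ⟨s ∪ s.image (Vertex.shift (N + 1)), ⟨hs'.1.mono Finset.subset_union_left,
      fun _ _ => Set.mem_univ _, ?_⟩, fun x hx => ⟨Finset.mem_union_right _
        (Finset.mem_image_of_mem _ hx), Finset.mem_union_left _ hx⟩⟩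
    have hle : ∀ x ∈ s, x.index ≤ N := hs'.2.1
    intro x hx y hy hxy
    rcases Finset.mem_union.1 hx with hx | hx <;> rcases Finset.mem_union.1 hy with hy | hy
    · exact hs'.2.2 x hx y hy hxy
    · obtain ⟨z, hz, rfl⟩ := Finset.mem_image.1 hy
      have := hle x hx
      simp only [Vertex.shift] at hxy
      omega
    · obtain ⟨z, hz, rfl⟩ := Finset.mem_image.1 hx
      have := hle y hy
      simp only [Vertex.shift] at hxy
      omega
    · obtain ⟨z, hz, rfl⟩ := Finset.mem_image.1 hx
      obtain ⟨w, hw, rfl⟩ := Finset.mem_image.1 hy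
      rw [hs'.2.2 z hz w hw (Nat.add_right_cancel hxy)]
  have key := fun F : GenericMap ρ n => pullbackCochain_sub_mem_coboundaries (G := G)
    (Vertex.shift (N + 1)) id (fun _ _ => rfl) (fun _ _ => rfl) hfg (eulerCochain_mem_cocycles ρ b F)
  have := sub_mem (key F) (key F')
  convert this using 1
  -- What remains is the difference of the pullbacks along the shift. It is zero because shifted
  -- vertices have index above `N`, where `F` and `F'` agree.
  rw [sub_sub_sub_comm]
  refine (sub_eq_self.2 (sub_eq_zero.2 (Subtype.ext (funext fun v => ?_)))).symm
  refine congrArg (zeroCount b) (funext fun i => h _ ?_)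
  simp only [Vertex.shift]
  omega

theorem GenericMap.zero_mem_translate_iff (F : GenericMap ρ n) (g : G) (s : Finset (Vertex G)) :
    (0 : V) ∈ convexHull ℝ (F.toFun '' (translate g s : Finset (Vertex G))) ↔
      (0 : V) ∈ convexHull ℝ (F.toFun '' (s : Set (Vertex G))) := by
  have key : ∀ (g : G) (s : Finset (Vertex G)),
      (0 : V) ∈ convexHull ℝ (F.toFun '' (s : Set (Vertex G))) →
      (0 : V) ∈ convexHull ℝ (F.toFun '' (translate g s : Finset (Vertex G))) := by
    intro g s h
    have : F.toFun '' (translate g s : Finset (Vertex G)) =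
        ρ g '' (F.toFun '' (s : Set (Vertex G))) := by
      simp [translate, Set.image_image, F.equivariant]
    rw [this, ← LinearMap.image_convexHull]
    exact ⟨0, h, map_zero _⟩
  refine ⟨fun h => ?_, key g s⟩
  have := key g⁻¹ _ h
  rwa [show translate g⁻¹ (translate g s) = s by ext x; simp [translate]] at this

/-- Needed because `Set.ncard` is zero on infinite sets. -/
theorem finite_faceOrbits [Finite G] {N : ℕ} {Z : PreAbstractSimplicialComplex (Vertex G)}
    (hZ : Z ≤ EG G N) : (faceOrbits G Z n).Finite := by
  refine ((finite_faces_EG G N).image fun s => {t | ∃ g : G, t = translate g s}).subset ?_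
  rintro O ⟨s, hs, -, rfl⟩
  exact ⟨s, hZ hs, rfl⟩

/-- If there are fewer than `2 ^ n` orbits of `n`-faces, then some sign change of a generic map has
no zero on the `n`-faces. -/
theorem GenericMap.exists_flip_forall_zero_notMem [Finite G] (F : GenericMap ρ n) {N : ℕ}
    {Z : PreAbstractSimplicialComplex (Vertex G)} (hZ : Z ≤ EG G N)
    (hlt : (faceOrbits G Z n).ncard < 2 ^ n) :
    ∃ S ⊆ Finset.range (N + 1), ∀ s ∈ Z.faces, s.card = n + 1 →
      (0 : V) ∉ convexHull ℝ ((F.flip S).toFun '' (s : Set (Vertex G))) := by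
  classical
  set I := Finset.range (N + 1) with hI
  by_contra! hcon
  -- `r O` is a representative face of the orbit `O`.
  choose! r hrZ hrc hr using fun (O : Set (Finset (Vertex G))) (h : O ∈ faceOrbits G Z n) => h
  set 𝒪 := (finite_faceOrbits (n := n) hZ).toFinset with h𝒪
  have mem𝒪 : ∀ {O}, O ∈ 𝒪 ↔ O ∈ faceOrbits G Z n := Set.Finite.mem_toFinset _
  set bad : Set (Finset (Vertex G)) → Finset (Finset ℕ) := fun O => I.powerset.filter fun S =>
    (0 : V) ∈ convexHull ℝ ((F.flip S).toFun '' (r O : Set (Vertex G))) with hbad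
  have hcover : I.powerset ⊆ 𝒪.biUnion bad := by
    intro S hS
    obtain ⟨s, hs, hsc, h0⟩ := hcon S (Finset.mem_powerset.1 hS)
    have hO : {t | ∃ g : G, t = translate g s} ∈ faceOrbits G Z n := ⟨s, hs, hsc, rfl⟩
    refine Finset.mem_biUnion.2 ⟨_, mem𝒪.2 hO, Finset.mem_filter.2 ⟨hS, ?_⟩⟩
    have hsO : s ∈ {t | ∃ g : G, t = translate g s} := ⟨1, by ext x; simp [translate]⟩
    rw [hr _ hO] at hsO
    obtain ⟨g, hg⟩ := hsO
    rw [hg, GenericMap.zero_mem_translate_iff] at h0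
    exact h0
  -- Union bound over the orbits, multiplied through by `2 ^ n` to avoid a subtraction in the
  -- exponent.
  have h1 : 2 ^ I.card * 2 ^ n ≤ 𝒪.card * 2 ^ I.card := by
    calc 2 ^ I.card * 2 ^ n = I.powerset.card * 2 ^ n := by rw [Finset.card_powerset]
      _ ≤ (∑ O ∈ 𝒪, (bad O).card) * 2 ^ n :=
          Nat.mul_le_mul_right _ ((Finset.card_le_card hcover).trans Finset.card_biUnion_le)
      _ = ∑ O ∈ 𝒪, (bad O).card * 2 ^ n := Finset.sum_mul ..
      _ ≤ ∑ O ∈ 𝒪, 2 ^ I.card := by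
          refine Finset.sum_le_sum fun O hO => ?_
          have hf := hrZ O (mem𝒪.1 hO)
          refine F.card_flip_mul_le (EG_le_EGInf G N (hZ hf)) (hrc O (mem𝒪.1 hO)) fun x hx => ?_
          exact Finset.mem_range.2 (Nat.lt_succ_of_le ((hZ hf).2.1 x hx))
      _ = 𝒪.card * 2 ^ I.card := by simp
  rw [mul_comm] at h1
  have h2 := Nat.le_of_mul_le_mul_right h1 (by positivity)
  rw [Set.ncard_eq_toFinset_card _ (finite_faceOrbits hZ)] at hlt
  exact absurd hlt (not_lt.2 h2)

/-- Only genuine `n`-faces need checking: an ordered simplex with repeated vertices spans a face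
with at most `n` vertices, whose image misses the origin by genericity. -/
theorem restrictCochain_eulerCochain_eq_zero (b : Module.Basis (Fin n) ℝ V)
    {Z : PreAbstractSimplicialComplex (Vertex G)} (hZ : Z ≤ EGInf G) (F : GenericMap ρ n)
    (h : ∀ s ∈ Z.faces, s.card = n + 1 →
      (0 : V) ∉ convexHull ℝ (F.toFun '' (s : Set (Vertex G)))) :
    restrictCochain (signModule ρ) hZ n (eulerCochain ρ b F) = 0 := by
  classical
  refine Subtype.ext (funext fun v => ?_)
  change zeroCount b (fun i => F.toFun (v.1 i)) = 0
  refine if_neg ?_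
  set s : Finset (Vertex G) := Finset.univ.image v.1 with hs
  have hsZ : s ∈ Z.faces := by
    obtain ⟨t, ht, hv⟩ := v.2
    refine (Z.isRelLowerSet_faces ht).2 ?_ (Finset.univ_nonempty.image _)
    intro x hx
    obtain ⟨i, -, rfl⟩ := Finset.mem_image.1 hx
    exact hv i
  have hr : (Set.range fun i => F.toFun (v.1 i)) = F.toFun '' (s : Set (Vertex G)) := by
    rw [hs, Finset.coe_image, Finset.coe_univ, Set.image_univ, ← Set.range_comp]
    rfl
  rw [hr]
  have hc : s.card ≤ n + 1 := by simpa using Finset.card_image_le (s := Finset.univ) (f := v.1)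
  rcases hc.lt_or_eq with hc | hc
  · exact F.zero_notMem_convexHull (hZ hsZ) (Nat.lt_succ_iff.1 hc)
  · exact h s hsZ hc

end Shift

end EulerJoin

/-! ### The lower bound on the number of orbits -/

theorem corollary3 {G V : Type*} [Group G] [Finite G] [AddCommGroup V] [Module ℝ V]
    [FiniteDimensional ℝ V] (ρ : Representation ℝ G V) (n : ℕ) (hn : Module.finrank ℝ V = n)
    (N : ℕ) (Z : PreAbstractSimplicialComplex (EulerJoin.Vertex G))
    (hZ : Z ≤ EulerJoin.EG G N) (hinv : EulerJoin.IsInvariant G Z)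
    (η : EulerJoin.Cohomology (EulerJoin.signModule ρ) (EulerJoin.EGInf G) n)
    (hη : EulerJoin.IsEulerClass ρ n η)
    (hne : EulerJoin.restrict (EulerJoin.signModule ρ)
      (hZ.trans (EulerJoin.EG_le_EGInf G N)) n η ≠ 0) :
    2 ^ n ≤ (EulerJoin.faceOrbits G Z n).ncard := by
  by_contra! hlt
  obtain ⟨b, F, rfl⟩ := hη
  obtain ⟨S, hS, hzero⟩ := F.exists_flip_forall_zero_notMem hZ hlt
  refine hne ((QuotientAddGroup.eq_zero_iff _).2 (AddSubgroup.mem_addSubgroupOf.2 ?_))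
  -- `S` lies in `range (N + 1)`, so the flip changes nothing beyond the factor `N`.
  have key := EulerJoin.restrictCochain_eulerCochain_sub_mem b hZ F (F.flip S) fun x hx => by
    have : x.index ∉ S := fun h => by have := Finset.mem_range.1 (hS h); omega
    simp [EulerJoin.GenericMap.flip, EulerJoin.flipSign, this]
  rwa [EulerJoin.restrictCochain_eulerCochain_eq_zero b _ (F.flip S) hzero, sub_zero] at key
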